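/- Let $\mathcal H$ be a complex Hilbert space of finite dimension $N$, let $R=S^{\bullet}(\mathcal H^*)=\bigoplus_{k\ge 0}R_k$ be the algebra of polynomials on $\mathcal H$, where $R_k=S^k(\mathcal H^*)$ is the space of homogeneous polynomials of degree $k$, and let $d\geq 1$ be an integer. Let $I\subseteq R$ be an ideal generated by finitely many homogeneous polynomials, each of degree at most $d$, and let $$\mathcal X=V(I)=\{\psi\psi^* : \psi\in\mathcal H,\ \|\psi\|=1,\ f(\psi)=0 \text{ for all } f\in I\}$$ be the projective variety cut out by $I$. For a linear subspace $\mathcal U\subseteq\mathcal H$, let $I(\mathcal U)\subseteq R$ be the ideal generated by the linear forms vanishing on $\mathcal U$. For an ideal $J\subseteq R$ write $J_k=J\cap R_k$. We say that $\mathcal U$ is $\mathcal X$-tangled if $\{\psi\psi^*:\psi\in\mathcal U\}\cap\mathcal X=\emptyset$. Then, for every linear subspace $\mathcal U\subseteq\mathcal H$, the following are equivalent: 1. $\mathcal U$ is $\mathcal X$-tangled. 2. $I_k+I(\mathcal U)_k=R_k$ for $k=N(d-1)+1$. In other words, degree $k=N(d-1)+1$ of the Nullstellensatz hierarchy certifies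 every $\mathcal X$-tangled subspace. -/

import Mathlib

noncomputable section

namespace Tangled

variable (H : Type*) [NormedAddCommGroup H] [InnerProductSpace ℂ H]

/-- The algebra `R = S^•(H^*)` of polynomials on `H`. -/
abbrev PolyAlg : Type _ := SymmetricAlgebra ℂ (Module.Dual ℂ H)

/-- The degree-`k` component `R_k = S^k(H^*)`: the linear span of all products of `k` linear
forms (for `k = 0`, the constants). -/
def forms (k : ℕ) : Submodule ℂ (PolyAlg H) :=
  LinearMap.range (SymmetricAlgebra.ι ℂ (Module.Dual ℂ H)) ^ k

variable {H}

/-- Evaluation of polynomials at a vector `ψ`: the algebra homomorphism `R → ℂ` which sends a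
linear form `ℓ` to `ℓ ψ`. -/
def evalAt (ψ : H) : PolyAlg H →ₐ[ℂ] ℂ :=
  SymmetricAlgebra.lift (Module.Dual.eval ℂ H ψ)

/-- `I` is generated by finitely many forms, each of degree at most `d`. In particular `I` is
a homogeneous ideal. -/
def GeneratedInDegreeAtMost (I : Ideal (PolyAlg H)) (d : ℕ) : Prop :=
  ∃ S : Set (PolyAlg H), S.Finite ∧ (∀ f ∈ S, ∃ i ≤ d, f ∈ forms H i) ∧ I = Ideal.span S

/-- The degree-`k` component `I_k = I ∩ R_k`. -/
def component (I : Ideal (PolyAlg H)) (k : ℕ) : Submodule ℂ (PolyAlg H) :=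
  I.restrictScalars ℂ ⊓ forms H k

/-- The ideal `I(U)` generated by the linear forms which vanish on `U`. -/
def subspaceIdeal (U : Submodule ℂ H) : Ideal (PolyAlg H) :=
  Ideal.span (SymmetricAlgebra.ι ℂ (Module.Dual ℂ H) '' (U.dualAnnihilator : Set _))

/-- The projective variety `V(I)`: the set of all pure states `ψψ^*`, with `ψ` a unit vector, such
that every element of `I` vanishes at `ψ`. -/
def variety (I : Ideal (PolyAlg H)) : Set (H →L[ℂ] H) :=
  {ρ | ∃ ψ : H, ‖ψ‖ = 1 ∧ (∀ f ∈ I, evalAt ψ f = 0) ∧ ρ = InnerProductSpace.rankOne ℂ ψ ψ}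

/-- The subspace `U` is `X`-tangled: `{ψψ^* : ψ ∈ U} ∩ X = ∅`. -/
def IsTangled (X : Set (H →L[ℂ] H)) (U : Submodule ℂ H) : Prop :=
  {ρ : H →L[ℂ] H | ∃ ψ ∈ U, ρ = InnerProductSpace.rankOne ℂ ψ ψ} ∩ X = ∅

end Tangled

end

/-! Adjoin to the generators of `I` the linear forms vanishing on `U`. By homogeneity, `U` is
tangled exactly when the origin is the only common zero of this system, so the hard direction is an
effective projective Nullstellensatz, `mem_span_of_forall_eval_eq_zero`.

Let `W` be the degree-`d` part of the ideal generated by such a system in `n` variables. By the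
Nullstellensatz, a prime containing `W` contains every variable. The irrelevant ideal is not
associated to a quotient by fewer than `n` weakly regular elements (a depth count with `Ext`), so
prime avoidance finds a weakly regular sequence of `n` forms in `W`
(`exists_isWeaklyRegular_of_submodule`). The quotient by it has Hilbert series `(1 + t + ... +
t^(d-1))^n`, a polynomial of degree at most `n(d-1)`, so every form of larger degree lies in the
ideal.

Conversely, at a common zero in `U` both summands vanish, but some form of degree `k` does not. -/

/-! ### Depth of the polynomial ring via `Ext`. -/

open RingTheory.Sequence CategoryTheory Abelian in
/-- Dividing out a weakly regular sequence of length `r` lowers the range in which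
`Ext` vanishes by at most `r`. -/
theorem subsingleton_ext_quotient_of_isWeaklyRegular {R : Type*} [CommRing R]
    (N : ModuleCat R) (rs : List R) {M : Type _} [AddCommGroup M] [Module R M]
    (hrs : IsWeaklyRegular M rs) (n : ℕ)
    (h : ∀ i < n + rs.length, Subsingleton (Ext N (ModuleCat.of R M) i)) :
    ∀ i < n, Subsingleton
      (Ext N (ModuleCat.of R (M ⧸ (Ideal.ofList rs • ⊤ : Submodule R M))) i) := by
  induction rs generalizing M with
  | nil =>
    intro i hi
    have e : (M ⧸ (Ideal.ofList ([] : List R) • ⊤ : Submodule R M)) ≃ₗ[R] M :=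
      Submodule.quotEquivOfEqBot _ (by simp)
    exact ((extFunctorObj N i).mapIso e.toModuleIso).addCommGroupIsoToAddEquiv.subsingleton_congr.mpr
      (h i (by simpa using hi))
  | cons a rs ih =>
    intro i hi
    rw [isWeaklyRegular_cons_iff] at hrs
    have h' : ∀ i < n + rs.length,
        Subsingleton (Ext N (ModuleCat.of R (QuotSMulTop a M)) i) := by
      intro i hi
      have zero1 := AddCommGrpCat.isZero_of_iff_subsingleton.mpr
        (h i (by simp only [List.length_cons]; omega))
      have zero2 := AddCommGrpCat.isZero_of_iff_subsingleton.mpr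
        (h (i + 1) (by simp only [List.length_cons]; omega))
      have hs : IsSMulRegular (ModuleCat.of R M) a := hrs.1
      -- `Ext^i(N, M/aM)` sits between `Ext^i(N, M)` and `Ext^(i+1)(N, M)`; the shift costs one
      -- degree per element.
      exact AddCommGrpCat.subsingleton_of_isZero <| ShortComplex.Exact.isZero_of_both_zeros
        ((Ext.covariant_sequence_exact₃' N hs.smulShortComplex_shortExact) i (i + 1) rfl)
        (zero1.eq_zero_of_src _) (zero2.eq_zero_of_tgt _)
    have e := Submodule.quotOfListConsSMulTopEquivQuotSMulTopInner M a rs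
    exact ((extFunctorObj N i).mapIso e.toModuleIso).addCommGroupIsoToAddEquiv.subsingleton_congr.mpr
      (ih hrs.2 h' i hi)

namespace MvPolynomial

open RingTheory.Sequence

variable {K : Type*} [Field K] {n : ℕ}

/-- Membership is tested monomial by monomial, and multiplying by `X i` changes only the exponent of
`i`, which is outside `s`. -/
theorem mem_span_X_of_X_mul_mem {σ R : Type*} [CommSemiring R] {s : Set σ} {i : σ} (hi : i ∉ s)
    {f : MvPolynomial σ R} (h : X i * f ∈ Ideal.span (X '' s : Set (MvPolynomial σ R))) :
    f ∈ Ideal.span (X '' s : Set (MvPolynomial σ R)) := by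
  classical
  rw [mem_ideal_span_X_image] at h ⊢
  intro m hm
  obtain ⟨j, hj, hmj⟩ := h (Finsupp.single i 1 + m) (by
    rw [mem_support_iff, coeff_X_mul]
    exact mem_support_iff.mp hm)
  refine ⟨j, hj, ?_⟩
  have : i ≠ j := fun h => hi (h ▸ hj)
  simpa [Finsupp.single_apply, this] using hmj

variable (K n) in
/-- The list of all variables. -/
noncomputable def listX : List (MvPolynomial (Fin n) K) := List.ofFn X

@[simp] theorem length_listX : (listX K n).length = n := by simp [listX]

theorem isSMulRegular_quotient_iff {R : Type*} [CommRing R] (I : Ideal R) (g : R) :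
    IsSMulRegular (R ⧸ (I • ⊤ : Submodule R R)) g ↔ ∀ f, g * f ∈ I → f ∈ I := by
  have hI : (I • ⊤ : Submodule R R) = I := by simp
  rw [hI]
  rw [isSMulRegular_iff_right_eq_zero_of_smul]
  constructor
  · intro h f hf
    exact (Submodule.Quotient.mk_eq_zero I).mp (h (Submodule.Quotient.mk f)
      ((Submodule.Quotient.mk_eq_zero I).mpr hf))
  · intro h x
    obtain ⟨f, rfl⟩ := Submodule.Quotient.mk_surjective I x
    intro hf
    exact (Submodule.Quotient.mk_eq_zero I).mpr (h f ((Submodule.Quotient.mk_eq_zero I).mp hf))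

theorem isWeaklyRegular_listX : IsWeaklyRegular (MvPolynomial (Fin n) K) (listX K n) := by
  refine ⟨fun i hi => ?_⟩
  rw [isSMulRegular_quotient_iff]
  have hi' : i < n := by simpa using hi
  have : Ideal.ofList ((listX K n).take i) =
      Ideal.span (X '' {j : Fin n | j < (⟨i, hi'⟩ : Fin n)}) := by
    unfold Ideal.ofList
    congr 1
    ext f
    simp only [Set.mem_ofPred_eq, Set.mem_image, List.mem_take_iff_getElem, listX]
    constructor
    · rintro ⟨j, hj, rfl⟩
      simp only [List.length_ofFn, lt_inf_iff] at hj
      exact ⟨⟨j, hj.2⟩, by simpa using hj.1, by simp⟩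
    · rintro ⟨j, hj, rfl⟩
      exact ⟨j, by simpa using Fin.lt_def.mp hj, by simp⟩
  rw [this]
  intro f hf
  refine mem_span_X_of_X_mul_mem (i := ⟨i, hi'⟩) (by simp) ?_
  simpa [listX] using hf

theorem ofList_listX : Ideal.ofList (listX K n) = Ideal.span (Set.range X) := by
  unfold Ideal.ofList listX
  congr 1
  ext f
  simp [List.mem_ofFn]

theorem mem_span_range_X_iff {σ : Type*} (f : MvPolynomial σ K) :
    f ∈ Ideal.span (Set.range (X : σ → MvPolynomial σ K)) ↔ coeff 0 f = 0 := by
  rw [← Set.image_univ, mem_ideal_span_X_image]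
  constructor
  · intro h
    by_contra h0
    simpa using h 0 (mem_support_iff.mpr h0)
  · intro h m hm
    by_contra! hc
    have : m = 0 := by ext i; simpa using hc i
    exact mem_support_iff.mp hm (this ▸ h)

theorem span_range_X_ne_top {σ : Type*} :
    Ideal.span (Set.range (X : σ → MvPolynomial σ K)) ≠ ⊤ := by
  rw [Ne, Ideal.eq_top_iff_one, mem_span_range_X_iff]
  simp

open CategoryTheory Abelian in
-- Rees's characterization of depth: the variables form a regular sequence of length `n` in the
-- irrelevant ideal.
theorem subsingleton_ext_quotient_span_X (i : ℕ) (hi : i < n) :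
    Subsingleton (Ext (ModuleCat.of (MvPolynomial (Fin n) K) (MvPolynomial (Fin n) K ⧸
      Ideal.span (Set.range (X : Fin n → MvPolynomial (Fin n) K))))
      (ModuleCat.of (MvPolynomial (Fin n) K) (MvPolynomial (Fin n) K)) i) := by
  set m := Ideal.span (Set.range (X : Fin n → MvPolynomial (Fin n) K)) with hm
  have hlt : m • (⊤ : Submodule (MvPolynomial (Fin n) K) (MvPolynomial (Fin n) K)) < ⊤ := by
    simpa [lt_top_iff_ne_top] using span_range_X_ne_top (K := K) (σ := Fin n)
  have := (ModuleCat.exists_isRegular_tfae m n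
    (ModuleCat.of (MvPolynomial (Fin n) K) (MvPolynomial (Fin n) K)) hlt).out 3 0
  refine this.mp ⟨listX K n, length_listX, ?_, isWeaklyRegular_listX, ?_⟩ _ ?_ inferInstance ?_ i hi
  · intro r hr
    rw [hm, ← ofList_listX]
    exact Ideal.subset_span hr
  · rw [ofList_listX]
    exact hlt.ne'
  · exact Ideal.Quotient.nontrivial_iff.mpr span_range_X_ne_top
  · change Module.support _ (_ ⧸ m) ⊆ _
    rw [Module.support_eq_zeroLocus, Ideal.annihilator_quotient]

open CategoryTheory Abelian in
/-- Fewer than `n` weakly regular elements cannot make the irrelevant ideal associated. -/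
theorem span_X_notMem_associatedPrimes (rs : List (MvPolynomial (Fin n) K))
    (hrs : IsWeaklyRegular (MvPolynomial (Fin n) K) rs) (hlen : rs.length < n) :
    Ideal.span (Set.range X) ∉ associatedPrimes (MvPolynomial (Fin n) K)
      (MvPolynomial (Fin n) K ⧸
        (Ideal.ofList rs • ⊤ : Submodule (MvPolynomial (Fin n) K) (MvPolynomial (Fin n) K))) := by
  intro hmem
  rw [AssociatedPrimes.mem_iff, isAssociatedPrime_iff_exists_injective_linearMap] at hmem
  obtain ⟨hp, f, hf⟩ := hmem
  have h := subsingleton_ext_quotient_of_isWeaklyRegular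
    (ModuleCat.of (MvPolynomial (Fin n) K) (MvPolynomial (Fin n) K ⧸
      Ideal.span (Set.range (X : Fin n → MvPolynomial (Fin n) K)))) rs hrs (n - rs.length)
    (fun i hi => subsingleton_ext_quotient_span_X i (by omega)) 0 (by omega)
  -- `Ext^0` is `Hom`, so the embedding that an associated prime provides must be zero.
  have := (Ext.addEquiv₀.trans ModuleCat.homAddEquiv).subsingleton_congr.mp h
  have hf0 : f = 0 := Subsingleton.elim (α := _ →ₗ[MvPolynomial (Fin n) K] _) _ _
  have : Nontrivial (MvPolynomial (Fin n) K ⧸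
      Ideal.span (Set.range (X : Fin n → MvPolynomial (Fin n) K))) :=
    Ideal.Quotient.nontrivial_iff.mpr span_range_X_ne_top
  obtain ⟨x, hx⟩ := exists_ne (0 : MvPolynomial (Fin n) K ⧸
      Ideal.span (Set.range (X : Fin n → MvPolynomial (Fin n) K)))
  exact hx (hf (by simp [hf0]))

end MvPolynomial
-- Regular sequences by prime avoidance.
namespace MvPolynomial

open RingTheory.Sequence

variable {K : Type*} [Field K] {n : ℕ}

theorem eq_span_X_of_forall_X_mem {σ : Type*} {P : Ideal (MvPolynomial σ K)} (hP : P ≠ ⊤)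
    (h : ∀ i, X i ∈ P) : P = Ideal.span (Set.range X) := by
  have hle : Ideal.span (Set.range X) ≤ P := Ideal.span_le.mpr (by rintro _ ⟨i, rfl⟩; exact h i)
  refine le_antisymm (fun f hf => ?_) hle
  rw [mem_span_range_X_iff]
  by_contra hc
  apply hP
  have h1 : f - C (coeff 0 f) ∈ P := hle (by rw [mem_span_range_X_iff]; simp)
  have h2 : C (coeff 0 f) ∈ P := by simpa using P.sub_mem hf h1
  exact P.eq_top_of_isUnit_mem h2 ((isUnit_iff_ne_zero.mpr hc).map C)

/-- A linear space of polynomials which lies in no prime ideal other than the irrelevant one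
contains weakly regular sequences of every length up to the number of variables. -/
theorem exists_isWeaklyRegular_of_submodule [Infinite K]
    (W : Submodule K (MvPolynomial (Fin n) K))
    (hW : ∀ P : Ideal (MvPolynomial (Fin n) K), P.IsPrime → W ≤ P.restrictScalars K →
      ∀ i, X i ∈ P) (r : ℕ) (hr : r ≤ n) :
    ∃ rs : List (MvPolynomial (Fin n) K), rs.length = r ∧ (∀ g ∈ rs, g ∈ W) ∧
      IsWeaklyRegular (MvPolynomial (Fin n) K) rs := by
  classical
  induction r with
  | zero => exact ⟨[], by simp⟩
  | succ r ih =>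
    obtain ⟨rs, hlen, hmem, hreg⟩ := ih (by omega)
    set M := MvPolynomial (Fin n) K ⧸
      (Ideal.ofList rs • ⊤ : Submodule (MvPolynomial (Fin n) K) (MvPolynomial (Fin n) K)) with hM
    have hfin := associatedPrimes.finite (MvPolynomial (Fin n) K) M
    let s : Finset (Subspace K W) :=
      hfin.toFinset.image (fun P => (P.restrictScalars K).comap W.subtype)
    have hs : ⊤ ∉ s := by
      intro htop
      obtain ⟨P, hP, hPtop⟩ := Finset.mem_image.mp htop
      rw [Set.Finite.mem_toFinset] at hP
      have hprime := hP.isPrime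
      have hle : W ≤ P.restrictScalars K := by
        rw [← Submodule.comap_subtype_eq_top]
        exact hPtop
      have := eq_span_X_of_forall_X_mem hprime.ne_top (hW P hprime hle)
      rw [this] at hP
      exact span_X_notMem_associatedPrimes rs hreg (by omega) hP
    -- Over an infinite field, `W` is not a finite union of proper subspaces; a `g` outside all
    -- associated primes is a nonzerodivisor.
    obtain ⟨g, hg⟩ := (Set.ne_univ_iff_exists_notMem _).mp
      (Subspace.biUnion_ne_univ_of_top_notMem hs)
    have hgreg : IsSMulRegular M (g : MvPolynomial (Fin n) K) := by
      rw [isSMulRegular_iff_right_eq_zero_of_smul]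
      intro x hx
      by_contra hx0
      have hmem : (g : MvPolynomial (Fin n) K) ∈
          {r : MvPolynomial (Fin n) K | ∃ x : M, x ≠ 0 ∧ r • x = 0} := ⟨x, hx0, hx⟩
      rw [← biUnion_associatedPrimes_eq_zero_divisors] at hmem
      obtain ⟨P, hP, hgP⟩ := Set.mem_iUnion₂.mp hmem
      exact hg (Set.mem_iUnion₂.mpr ⟨_, Finset.mem_image_of_mem _ (hfin.mem_toFinset.mpr hP), hgP⟩)
    refine ⟨rs ++ [(g : MvPolynomial (Fin n) K)], by simp [hlen], ?_, ?_⟩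
    · intro f hf
      rcases List.mem_append.mp hf with hf | hf
      · exact hmem f hf
      · rw [List.mem_singleton.mp hf]
        exact g.2
    · rw [isWeaklyRegular_append_iff, isWeaklyRegular_singleton_iff]
      exact ⟨hreg, hgreg⟩

/-- A prime ideal which contains the degree-`d` part of an ideal generated by forms of degree at
most `d` with no common zero but the origin contains every variable. -/
theorem X_mem_of_component_le [IsAlgClosed K] {σ : Type*} [Finite σ] {d : ℕ}
    {S : Set (MvPolynomial σ K)} (hS : ∀ f ∈ S, ∃ i ≤ d, f.IsHomogeneous i)
    (hV : ∀ x : σ → K, (∀ f ∈ S, eval x f = 0) → x = 0)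
    (P : Ideal (MvPolynomial σ K)) (hP : P.IsPrime)
    (hle : (Ideal.span S).restrictScalars K ⊓ homogeneousSubmodule σ K d ≤ P.restrictScalars K)
    (i : σ) : X i ∈ P := by
  by_contra hi
  have hSP : Ideal.span S ≤ P := by
    rw [Ideal.span_le]
    intro f hf
    obtain ⟨e, he, hfe⟩ := hS f hf
    -- A power of `X i` raises `f` to degree exactly `d`; since `X i ∉ P`, primality then cancels
    -- it.
    have hmem : X i ^ (d - e) * f ∈ P := hle ⟨Ideal.mul_mem_left _ _ (Ideal.subset_span hf), by
      have := (isHomogeneous_X_pow (R := K) i (d - e)).mul hfe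
      rwa [Nat.sub_add_cancel he] at this⟩
    exact (hP.mem_or_mem hmem).resolve_left fun h => hi (hP.mem_of_pow_mem _ h)
  apply hi
  rw [← IsPrime.vanishingIdeal_zeroLocus (K := K) P]
  rw [mem_vanishingIdeal_iff]
  intro x hx
  have hx0 : x = 0 := hV x fun f hf => by
    simpa [aeval_eq_eval] using hx f (hSP (Ideal.subset_span hf))
  simp [hx0]

end MvPolynomial
-- Hilbert series of quotients by regular sequences.
namespace MvPolynomial

open RingTheory.Sequence

variable {K : Type*} [Field K] {σ : Type*}

/-- The degree-`k` component of `K[X] ⧸ I`. -/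
noncomputable def quotientComponent (I : Ideal (MvPolynomial σ K)) (k : ℕ) :
    Submodule K (MvPolynomial σ K ⧸ I) :=
  (homogeneousSubmodule σ K k).map (Ideal.Quotient.mkₐ K I).toLinearMap

instance [Finite σ] (I : Ideal (MvPolynomial σ K)) (k : ℕ) :
    FiniteDimensional K (quotientComponent I k) :=
  Module.Finite.iff_fg.mpr ((homogeneousSubmodule_fg σ K k).map _)

/-- The ideal contains the homogeneous components of its elements. -/
def IsGraded (I : Ideal (MvPolynomial σ K)) : Prop :=
  ∀ f ∈ I, ∀ k, homogeneousComponent k f ∈ I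

theorem isGraded_span {S : Set (MvPolynomial σ K)} (hS : ∀ f ∈ S, ∃ i, f.IsHomogeneous i) :
    IsGraded (Ideal.span S) := by
  let := gradedAlgebra (σ := σ) (R := K)
  have := Ideal.homogeneous_span (homogeneousSubmodule σ K) S hS
  exact fun f hf k => homogeneousComponent_mem_of_mem this hf k

theorem homogeneousComponent_isHomogeneous_mul {g : MvPolynomial σ K} {e : ℕ}
    (hg : g.IsHomogeneous e) (f : MvPolynomial σ K) (k : ℕ) :
    homogeneousComponent k (g * f) = if e ≤ k then g * homogeneousComponent (k - e) f else 0 := by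
  classical
  conv_lhs => rw [← sum_homogeneousComponent f, Finset.mul_sum, map_sum]
  have h1 : ∀ i, homogeneousComponent k (g * homogeneousComponent i f) =
      if e + i = k then g * homogeneousComponent i f else 0 := fun i => by
    rw [homogeneousComponent_of_mem (n := e + i)
      (hg.mul (homogeneousComponent_isHomogeneous i f))]
    simp only [eq_comm]
  simp only [h1]
  split_ifs with h
  · have h2 : ∀ i, e + i = k ↔ i = k - e := fun i => by omega
    simp only [h2, Finset.sum_ite_eq', Finset.mem_range]
    split_ifs with h3
    · rfl
    · rw [homogeneousComponent_eq_zero _ _ (by omega), mul_zero]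
  · exact Finset.sum_eq_zero fun i _ => if_neg (by omega)

/-- With `A` the polynomial ring and `J = I + (g)`, this counts dimensions in `0 → (A/I)_(k-e) →
(A/I)_k → (A/J)_k → 0`, whose first map is multiplication by `g`. The case split guards against
truncated `k - e`. -/
theorem finrank_quotientComponent_sup_span [Finite σ] {I : Ideal (MvPolynomial σ K)}
    (hI : IsGraded I) {g : MvPolynomial σ K} {e : ℕ} (hg : g.IsHomogeneous e)
    (hreg : ∀ f, g * f ∈ I → f ∈ I) (k : ℕ) :
    Module.finrank K (quotientComponent (I ⊔ Ideal.span {g}) k) +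
      (if e ≤ k then Module.finrank K (quotientComponent I (k - e)) else 0) =
    Module.finrank K (quotientComponent I k) := by
  set J := I ⊔ Ideal.span {g} with hJ
  let π : MvPolynomial σ K ⧸ I →ₗ[K] MvPolynomial σ K ⧸ J :=
    (Ideal.Quotient.factorₐ K (le_sup_left : I ≤ J)).toLinearMap
  have hπ : ∀ f, π (Ideal.Quotient.mk I f) = Ideal.Quotient.mk J f := fun f => rfl
  let φ := π.domRestrict (quotientComponent I k)
  have hrange : LinearMap.range φ = quotientComponent J k := by
    rw [LinearMap.range_domRestrict]
    unfold quotientComponent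
    rw [← Submodule.map_comp]
    rfl
  rw [← LinearMap.finrank_range_add_finrank_ker φ, hrange]
  congr 1
  have hcomp : ∀ j, Module.finrank K (quotientComponent I (j - e)) =
      Module.finrank K ((quotientComponent I (j - e)).map
        (LinearMap.mulLeft K (Ideal.Quotient.mk I g))) := fun j => by
    refine (Submodule.equivMapOfInjective _ ?_ _).finrank_eq
    rw [← LinearMap.ker_eq_bot, LinearMap.ker_eq_bot']
    intro x hx
    obtain ⟨f, rfl⟩ := Ideal.Quotient.mk_surjective x
    rw [LinearMap.mulLeft_apply, ← map_mul, Ideal.Quotient.eq_zero_iff_mem] at hx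
    exact Ideal.Quotient.eq_zero_iff_mem.mpr (hreg f hx)
  have hker : (LinearMap.ker φ).map (quotientComponent I k).subtype =
      if e ≤ k then (quotientComponent I (k - e)).map
        (LinearMap.mulLeft K (Ideal.Quotient.mk I g)) else ⊥ := by
    apply le_antisymm
    · rintro _ ⟨⟨_, ⟨f, hf, rfl⟩⟩, hx, rfl⟩
      have hfJ : f ∈ J := Ideal.Quotient.eq_zero_iff_mem.mp hx
      obtain ⟨p, hp, q, hq, hpq⟩ := Submodule.mem_sup.mp hfJ
      obtain ⟨q, rfl⟩ := Ideal.mem_span_singleton'.mp hq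
      -- Comparing degree-`k` parts makes the cofactor of `g` homogeneous; gradedness keeps the part
      -- of `p` in `I`.
      have hfk : f = homogeneousComponent k p +
          if e ≤ k then g * homogeneousComponent (k - e) q else 0 := by
        rw [← homogeneousComponent_isHomogeneous_mul hg, ← map_add, mul_comm, hpq]
        exact (homogeneousComponent_eq_self hf).symm
      have hmk : Ideal.Quotient.mk I f = Ideal.Quotient.mk I
          (if e ≤ k then g * homogeneousComponent (k - e) q else 0) := by
        rw [Ideal.Quotient.eq]
        nth_rw 1 [hfk]
        simpa using hI p hp k
      change Ideal.Quotient.mk I f ∈ _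
      rw [hmk]
      split_ifs
      · exact ⟨_, ⟨_, homogeneousComponent_isHomogeneous (k - e) q, rfl⟩, (map_mul _ _ _).symm⟩
      · exact map_zero _
    · split_ifs with h
      · rintro _ ⟨_, ⟨q, hq, rfl⟩, rfl⟩
        refine ⟨⟨Ideal.Quotient.mk I (g * q), ⟨g * q, ?_, rfl⟩⟩, ?_, map_mul (Ideal.Quotient.mk I) g q⟩
        · have := hg.mul ((mem_homogeneousSubmodule _ _).mp hq)
          rwa [Nat.add_sub_cancel' h] at this
        · exact Ideal.Quotient.eq_zero_iff_mem.mpr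
            (Ideal.mul_mem_right _ _ (le_sup_right (a := I) (Ideal.mem_span_singleton_self g)))
      · exact bot_le
  rw [(Submodule.equivMapOfInjective _ (Submodule.subtype_injective _) (LinearMap.ker φ)).finrank_eq,
    hker]
  by_cases h : e ≤ k
  · rw [if_pos h, if_pos h, hcomp]
  · rw [if_neg h, if_neg h, finrank_bot]

/-- The Hilbert series of `K[X] ⧸ I`. -/
noncomputable def hilbertSeries (I : Ideal (MvPolynomial σ K)) : PowerSeries ℤ :=
  PowerSeries.mk fun k => (Module.finrank K (quotientComponent I k) : ℤ)

theorem hilbertSeries_sup_span [Finite σ] {I : Ideal (MvPolynomial σ K)}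
    (hI : IsGraded I) {g : MvPolynomial σ K} {e : ℕ} (hg : g.IsHomogeneous e)
    (hreg : ∀ f, g * f ∈ I → f ∈ I) :
    hilbertSeries (I ⊔ Ideal.span {g}) = (1 - PowerSeries.X ^ e) * hilbertSeries I := by
  ext k
  have h := finrank_quotientComponent_sup_span hI hg hreg k
  rw [sub_mul, one_mul, map_sub, PowerSeries.coeff_X_pow_mul']
  simp only [hilbertSeries, PowerSeries.coeff_mk]
  rw [← h]
  push_cast
  ring

theorem hilbertSeries_ofList [Finite σ] {e : ℕ} (rs : List (MvPolynomial σ K))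
    (hrs : IsWeaklyRegular (MvPolynomial σ K) rs) (hhom : ∀ g ∈ rs, g.IsHomogeneous e) :
    hilbertSeries (Ideal.ofList rs) =
      (1 - PowerSeries.X ^ e) ^ rs.length * hilbertSeries (⊥ : Ideal (MvPolynomial σ K)) := by
  induction rs using List.reverseRecOn with
  | nil => simp
  | append_singleton rs g ih =>
    rw [isWeaklyRegular_append_iff, isWeaklyRegular_singleton_iff, isSMulRegular_quotient_iff] at hrs
    rw [Ideal.ofList_append, Ideal.ofList_singleton,
      hilbertSeries_sup_span (isGraded_span fun f hf => ⟨e, hhom f (by simp_all)⟩)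
        (hhom g (by simp)) hrs.2, ih hrs.1 fun f hf => hhom f (by simp [hf])]
    simp [pow_succ']
    ring

theorem quotientComponent_eq_bot_iff {I : Ideal (MvPolynomial σ K)} {k : ℕ} :
    quotientComponent I k = ⊥ ↔ ∀ f : MvPolynomial σ K, f.IsHomogeneous k → f ∈ I := by
  unfold quotientComponent
  rw [eq_bot_iff, Submodule.map_le_iff_le_comap]
  exact forall₂_congr fun f _ => Ideal.Quotient.eq_zero_iff_mem

theorem hilbertSeries_span_X :
    hilbertSeries (Ideal.span (Set.range (X : σ → MvPolynomial σ K))) = 1 := by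
  ext k
  simp only [hilbertSeries, PowerSeries.coeff_mk, PowerSeries.coeff_one]
  split_ifs with hk
  · subst hk
    have : quotientComponent (Ideal.span (Set.range (X : σ → MvPolynomial σ K))) 0 =
        Submodule.span K {1} := by
      unfold quotientComponent
      rw [homogeneousSubmodule_zero, Submodule.one_eq_span, Submodule.map_span]
      simp
    have hnt : Nontrivial (MvPolynomial σ K ⧸ Ideal.span (Set.range (X : σ → MvPolynomial σ K))) :=
      Ideal.Quotient.nontrivial_iff.mpr span_range_X_ne_top
    rw [this, finrank_span_singleton one_ne_zero, Nat.cast_one]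
  · rw [quotientComponent_eq_bot_iff.mpr fun f hf => ?_, finrank_bot, Nat.cast_zero]
    rw [mem_span_range_X_iff]
    exact hf.coeff_eq_zero (by simpa using Ne.symm hk)

/-- The series of the polynomial ring need not be computed: the variables, with `e = 1`, show that
`(1 - t)^n` times it is `1`. -/
theorem hilbertSeries_ofList_of_length_eq {n e : ℕ} (rs : List (MvPolynomial (Fin n) K))
    (hrs : IsWeaklyRegular (MvPolynomial (Fin n) K) rs) (hhom : ∀ g ∈ rs, g.IsHomogeneous e)
    (hlen : rs.length = n) :
    hilbertSeries (Ideal.ofList rs) =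
      (((∑ i ∈ Finset.range e, Polynomial.X ^ i) ^ n : Polynomial ℤ) : PowerSeries ℤ) := by
  have hX := hilbertSeries_ofList (e := 1) (listX K n) isWeaklyRegular_listX (by
    intro g hg
    obtain ⟨i, rfl⟩ := List.mem_ofFn.mp hg
    exact isHomogeneous_X _ _)
  rw [ofList_listX, hilbertSeries_span_X, length_listX, pow_one] at hX
  have hgeom : (1 - PowerSeries.X ^ e : PowerSeries ℤ) =
      (∑ i ∈ Finset.range e, PowerSeries.X ^ i) * (1 - PowerSeries.X) :=
    (geom_sum_mul_neg _ _).symm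
  rw [hilbertSeries_ofList rs hrs hhom, hlen, hgeom, mul_pow, mul_assoc, ← hX, mul_one]
  rw [← Polynomial.coeToPowerSeries.ringHom_apply, map_pow, map_sum]
  simp

/-- A weakly regular sequence of `n` forms of degree `e` generates all forms of degree
greater than `n * (e - 1)`. -/
theorem mem_ofList_of_isWeaklyRegular {n e k : ℕ} (rs : List (MvPolynomial (Fin n) K))
    (hrs : IsWeaklyRegular (MvPolynomial (Fin n) K) rs) (hhom : ∀ g ∈ rs, g.IsHomogeneous e)
    (hlen : rs.length = n) (hk : n * (e - 1) < k) (f : MvPolynomial (Fin n) K)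
    (hf : f.IsHomogeneous k) : f ∈ Ideal.ofList rs := by
  have h := congrArg (PowerSeries.coeff k) (hilbertSeries_ofList_of_length_eq rs hrs hhom hlen)
  have hdeg : ((∑ i ∈ Finset.range e, Polynomial.X ^ i) ^ n : Polynomial ℤ).natDegree < k := by
    refine lt_of_le_of_lt (Polynomial.natDegree_pow_le_of_le n
      (Polynomial.natDegree_sum_le_of_forall_le _ _ fun i hi => ?_)) hk
    rw [Polynomial.natDegree_X_pow]
    have := Finset.mem_range.mp hi
    omega
  rw [Polynomial.coeff_coe, Polynomial.coeff_eq_zero_of_natDegree_lt hdeg] at h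
  simp only [hilbertSeries, PowerSeries.coeff_mk, Nat.cast_eq_zero] at h
  exact quotientComponent_eq_bot_iff.mp (Submodule.finrank_eq_zero.mp h) f hf

end MvPolynomial
-- The effective Nullstellensatz in coordinates.
namespace MvPolynomial

/-- **Effective projective Nullstellensatz**: forms of degree at most `d` in `n` variables whose
only common zero is the origin generate all forms of degree greater than `n * (d - 1)`. -/
theorem mem_span_of_forall_eval_eq_zero {K : Type*} [Field K] [IsAlgClosed K] {n d k : ℕ}
    {S : Set (MvPolynomial (Fin n) K)} (hS : ∀ f ∈ S, ∃ i ≤ d, f.IsHomogeneous i)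
    (hV : ∀ x : Fin n → K, (∀ f ∈ S, eval x f = 0) → x = 0) (hk : n * (d - 1) < k)
    (f : MvPolynomial (Fin n) K) (hf : f.IsHomogeneous k) : f ∈ Ideal.span S := by
  have : Infinite K := IsAlgClosed.instInfinite
  obtain ⟨rs, hlen, hmem, hreg⟩ := exists_isWeaklyRegular_of_submodule
    ((Ideal.span S).restrictScalars K ⊓ homogeneousSubmodule (Fin n) K d)
    (X_mem_of_component_le hS hV) n le_rfl
  have hle : Ideal.ofList rs ≤ Ideal.span S := Ideal.span_le.mpr fun g hg => (hmem g hg).1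
  exact hle (mem_ofList_of_isWeaklyRegular rs hreg (fun g hg => (hmem g hg).2) hlen hk f hf)

end MvPolynomial

/-! ### Transfer to the symmetric algebra and the equivalence. -/

namespace Tangled

open MvPolynomial

variable {H : Type*} [NormedAddCommGroup H] [InnerProductSpace ℂ H]

theorem evalAt_ι (ψ : H) (ℓ : Module.Dual ℂ H) :
    evalAt ψ (SymmetricAlgebra.ι ℂ (Module.Dual ℂ H) ℓ) = ℓ ψ := by
  simp [evalAt]

theorem evalAt_smul (c : ℂ) (ψ : H) {k : ℕ} {f : PolyAlg H} (hf : f ∈ forms H k) :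
    evalAt (c • ψ) f = c ^ k * evalAt ψ f := by
  unfold forms at hf
  induction hf using Submodule.pow_induction_on_left' with
  | algebraMap r => simp
  | add x y i hx hy ihx ihy => rw [map_add, map_add, ihx, ihy, mul_add]
  | mem_mul m hm i x hx ih =>
    obtain ⟨ℓ, rfl⟩ := hm
    rw [map_mul, map_mul, ih, evalAt_ι, evalAt_ι, map_smul, smul_eq_mul, Nat.succ_eq_add_one]
    ring

section Basis

variable {n : ℕ} (b : Module.Basis (Fin n) ℂ (Module.Dual ℂ H))

theorem equivMvPolynomial_mem_homogeneousSubmodule_iff (k : ℕ) (f : PolyAlg H) :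
    (SymmetricAlgebra.equivMvPolynomial b f).IsHomogeneous k ↔ f ∈ forms H k := by
  have h1 : (LinearMap.range (SymmetricAlgebra.ι ℂ (Module.Dual ℂ H))).map
      (SymmetricAlgebra.equivMvPolynomial b).toAlgHom.toLinearMap =
      homogeneousSubmodule (Fin n) ℂ 1 := by
    rw [homogeneousSubmodule_one_eq_span_X, LinearMap.range_eq_map, ← b.span_eq,
      Submodule.map_span, Submodule.map_span, ← Set.range_comp, ← Set.range_comp]
    congr 2
    ext i
    simp
  have h2 : (forms H k).map (SymmetricAlgebra.equivMvPolynomial b).toAlgHom.toLinearMap =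
      homogeneousSubmodule (Fin n) ℂ k := by
    rw [forms, Submodule.map_pow, h1, homogeneousSubmodule_one_pow]
  rw [← mem_homogeneousSubmodule, ← h2]
  constructor
  · rintro ⟨g, hg, hgf⟩
    rwa [← (SymmetricAlgebra.equivMvPolynomial b).injective hgf]
  · exact fun hf => ⟨f, hf, rfl⟩

theorem eval_equivMvPolynomial (ψ : H) (f : PolyAlg H) :
    eval (fun i => b i ψ) (SymmetricAlgebra.equivMvPolynomial b f) = evalAt ψ f := by
  have : (aeval (fun i => b i ψ)).comp (SymmetricAlgebra.equivMvPolynomial b).toAlgHom =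
      evalAt ψ := by
    apply SymmetricAlgebra.algHom_ext
    refine b.ext fun i => ?_
    simp [evalAt_ι]
  rw [← this]
  simp [aeval_eq_eval]

theorem equivMvPolynomial_mem_span_image_iff (S : Set (PolyAlg H)) (f : PolyAlg H) :
    SymmetricAlgebra.equivMvPolynomial b f ∈
      Ideal.span (SymmetricAlgebra.equivMvPolynomial b '' S) ↔ f ∈ Ideal.span S := by
  rw [← Ideal.map_span, Ideal.mem_map_of_equiv]
  simp

end Basis

/-- Ideals generated by forms have the property that the degree-`k` part of their sum is the sum
of their degree-`k` parts. -/
theorem mem_component_sup_component [FiniteDimensional ℂ H] {S T : Set (PolyAlg H)}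
    (hS : ∀ f ∈ S, ∃ i, f ∈ forms H i) (hT : ∀ f ∈ T, ∃ i, f ∈ forms H i) {k : ℕ}
    {f : PolyAlg H} (hf : f ∈ forms H k) (hfST : f ∈ Ideal.span S ⊔ Ideal.span T) :
    f ∈ component (Ideal.span S) k ⊔ component (Ideal.span T) k := by
  let b := Module.finBasis ℂ (Module.Dual ℂ H)
  let e := SymmetricAlgebra.equivMvPolynomial b
  obtain ⟨p, hp, q, hq, rfl⟩ := Submodule.mem_sup.mp hfST
  have key : ∀ (A : Set (PolyAlg H)), (∀ f ∈ A, ∃ i, f ∈ forms H i) → ∀ p ∈ Ideal.span A,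
      e.symm (homogeneousComponent k (e p)) ∈ component (Ideal.span A) k := by
    refine fun A hA p hp => ⟨?_, ?_⟩
    · change e.symm (homogeneousComponent k (e p)) ∈ Ideal.span A
      rw [← equivMvPolynomial_mem_span_image_iff b, AlgEquiv.apply_symm_apply]
      refine isGraded_span ?_ _ ((equivMvPolynomial_mem_span_image_iff b A p).mpr hp) k
      rintro _ ⟨g, hg, rfl⟩
      obtain ⟨i, hi⟩ := hA g hg
      exact ⟨i, (equivMvPolynomial_mem_homogeneousSubmodule_iff b i g).mpr hi⟩
    · rw [SetLike.mem_coe, ← equivMvPolynomial_mem_homogeneousSubmodule_iff b,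
        AlgEquiv.apply_symm_apply]
      exact homogeneousComponent_isHomogeneous _ _
  refine Submodule.mem_sup.mpr ⟨_, key S hS p hp, _, key T hT q hq, ?_⟩
  rw [← map_add, ← map_add, ← map_add, AlgEquiv.symm_apply_eq]
  exact homogeneousComponent_eq_self
    ((equivMvPolynomial_mem_homogeneousSubmodule_iff b k (p + q)).mpr hf)

theorem mem_of_forall_evalAt_eq_zero [FiniteDimensional ℂ H] {d k : ℕ} {S : Set (PolyAlg H)}
    (hS : ∀ f ∈ S, ∃ i ≤ d, f ∈ forms H i)
    (hV : ∀ ψ : H, (∀ f ∈ S, evalAt ψ f = 0) → ψ = 0) (hk : Module.finrank ℂ H * (d - 1) < k)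
    {f : PolyAlg H} (hf : f ∈ forms H k) : f ∈ Ideal.span S := by
  let b₀ := Module.finBasis ℂ H
  let b := b₀.dualBasis
  rw [← equivMvPolynomial_mem_span_image_iff b]
  refine mem_span_of_forall_eval_eq_zero (d := d) ?_ ?_ hk _
    ((equivMvPolynomial_mem_homogeneousSubmodule_iff b k f).mpr hf)
  · rintro _ ⟨g, hg, rfl⟩
    obtain ⟨i, hi, hgi⟩ := hS g hg
    exact ⟨i, hi, (equivMvPolynomial_mem_homogeneousSubmodule_iff b i g).mpr hgi⟩
  · intro x hx
    have hb : (fun i => b i (b₀.equivFun.symm x)) = x := by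
      ext i
      simp [b, Finsupp.single_apply]
    have h0 := hV (b₀.equivFun.symm x) fun g hg => by
      rw [← eval_equivMvPolynomial b, hb]
      exact hx _ ⟨g, hg, rfl⟩
    exact (LinearEquiv.map_eq_zero_iff _).mp h0

theorem evalAt_eq_zero_of_mem_subspaceIdeal {U : Submodule ℂ H} {ψ : H} (hψ : ψ ∈ U)
    {f : PolyAlg H} (hf : f ∈ subspaceIdeal U) : evalAt ψ f = 0 := by
  have : subspaceIdeal U ≤ RingHom.ker (evalAt ψ) := by
    refine Ideal.span_le.mpr ?_
    rintro _ ⟨ℓ, hℓ, rfl⟩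
    change evalAt ψ _ = 0
    rw [evalAt_ι]
    exact (Submodule.mem_dualAnnihilator ℓ).mp hℓ ψ hψ
  exact this hf

theorem isTangled_variety_iff (I : Ideal (PolyAlg H)) (U : Submodule ℂ H) :
    IsTangled (variety I) U ↔ ¬ ∃ ψ ∈ U, ‖ψ‖ = 1 ∧ ∀ f ∈ I, evalAt ψ f = 0 := by
  unfold IsTangled
  rw [← Set.not_nonempty_iff_eq_empty, not_iff_not]
  constructor
  · rintro ⟨_, ⟨φ, hφ, rfl⟩, ψ, hψ, hI, h⟩
    refine ⟨ψ, ?_, hψ, hI⟩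
    -- Applying both operators to `ψ` gives `ψ = ⟨φ, ψ⟩ φ`, so `ψ` lies in `U` along with `φ`.
    have h' := congrArg (fun A : H →L[ℂ] H => A ψ) h
    simp only [InnerProductSpace.rankOne_apply, inner_self_eq_norm_sq_to_K, hψ] at h'
    have h'' : inner ℂ φ ψ • φ = ψ := by simpa using h'
    rw [← h'']
    exact U.smul_mem _ hφ
  · rintro ⟨ψ, hψU, hψ, hI⟩
    exact ⟨_, ⟨ψ, hψU, rfl⟩, ψ, hψ, hI, rfl⟩

end Tangled

theorem mainTheorem2 {H : Type*} [NormedAddCommGroup H] [InnerProductSpace ℂ H]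
    [FiniteDimensional ℂ H] (d : ℕ) (hd : 1 ≤ d) (I : Ideal (Tangled.PolyAlg H))
    (hI : Tangled.GeneratedInDegreeAtMost I d) (U : Submodule ℂ H) :
    Tangled.IsTangled (Tangled.variety I) U ↔
      Tangled.component I (Module.finrank ℂ H * (d - 1) + 1) ⊔
          Tangled.component (Tangled.subspaceIdeal U) (Module.finrank ℂ H * (d - 1) + 1) =
        Tangled.forms H (Module.finrank ℂ H * (d - 1) + 1) := by
  open Tangled in
  obtain ⟨S, -, hS, rfl⟩ := hI
  set k := Module.finrank ℂ H * (d - 1) + 1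
  rw [isTangled_variety_iff]
  constructor
  · intro h
    refine le_antisymm (sup_le inf_le_right inf_le_right) fun f hf => ?_
    have hT : ∀ f ∈ SymmetricAlgebra.ι ℂ (Module.Dual ℂ H) '' (U.dualAnnihilator : Set _),
        f ∈ forms H 1 := by
      rintro _ ⟨ℓ, -, rfl⟩
      rw [forms, pow_one]
      exact ⟨ℓ, rfl⟩
    refine mem_component_sup_component (fun f hf => (hS f hf).imp fun _ h => h.2)
      (fun f hf => ⟨1, hT f hf⟩) hf ?_
    rw [← Ideal.span_union]
    refine mem_of_forall_evalAt_eq_zero (d := d) ?_ ?_ (Nat.lt_succ_self _) hf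
    · rintro g (hg | hg)
      · exact hS g hg
      -- Here `1 ≤ d` matters: the linear forms must also obey the degree bound.
      · exact ⟨1, hd, hT g hg⟩
    · intro ψ hψ
      by_contra hψ0
      -- Normalizing a nonzero common zero keeps it one, as the generators are homogeneous.
      refine h ⟨((‖ψ‖ : ℂ)⁻¹) • ψ, U.smul_mem _ ?_, norm_smul_inv_norm hψ0, fun f hf => ?_⟩
      · rw [← Subspace.forall_mem_dualAnnihilator_apply_eq_zero_iff]
        intro ℓ hℓ
        rw [← evalAt_ι]
        exact hψ _ (Or.inr ⟨ℓ, hℓ, rfl⟩)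
      · have hle : Ideal.span S ≤ RingHom.ker (evalAt (((‖ψ‖ : ℂ)⁻¹) • ψ)) := by
          refine Ideal.span_le.mpr fun g hg => ?_
          obtain ⟨i, -, hgi⟩ := hS g hg
          change evalAt _ g = 0
          rw [evalAt_smul _ _ hgi, hψ g (Or.inl hg), mul_zero]
        exact hle hf
  · rintro h ⟨ψ, hψU, hψ, hI⟩
    -- The form `⟨ψ, ·⟩^k` takes the value `1` at the unit vector `ψ`, where both components vanish.
    have hmem : SymmetricAlgebra.ι ℂ (Module.Dual ℂ H) (innerSL ℂ ψ).toLinearMap ^ k ∈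
        component (Ideal.span S) k ⊔ component (subspaceIdeal U) k := by
      rw [h]
      exact Submodule.pow_mem_pow _ (LinearMap.mem_range_self _ _) k
    obtain ⟨p, hp, q, hq, hpq⟩ := Submodule.mem_sup.mp hmem
    have h1 := congrArg (evalAt ψ) hpq
    rw [map_add, hI p hp.1, evalAt_eq_zero_of_mem_subspaceIdeal hψU hq.1, map_pow, evalAt_ι] at h1
    simp [hψ] at h1
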